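/- For $p,q,r\in\mathbb{R}^2$, let the orientation of $(p,q,r)$ be the sign in $\{1,0,-1\}$ of $\det\begin{pmatrix} p & q & r\\ 1&1&1\end{pmatrix}$ (positive for counterclockwise triples). Two point sets $P,Q\subset\mathbb{R}^2$ have the same order type if there is a bijection $P\to Q$ preserving the orientation of every ordered triple. The extreme points of a point set are the vertices of its convex hull. Let $n\ge 3$, let $\sigma$ be a permutation of $[n]=\{1,\dots,n\}$, and take indices modulo $n$. Let $\mathcal{F}_\sigma$ be the family of all configurations $\{a_k,b_k,c_k,d_k : k\in[n]\}\subset\mathbb{R}^2$ such that (i) the points $a_1,b_1,c_1,a_2,b_2,c_2,\dots,a_n,b_n,c_n$ are in convex position and appear in this counterclockwise order around their convex hull; (ii) for every $k\in[n]$, the point $d_{\sigma(k)}$ lies in the closed triangle formed by the three lines $\overline{a_{\sigma(k)}a_{\sigma(k+1)}}$, $\overline{b_{\sigma(k)}b_{\sigma(k+1)}}$, $\overline{c_{\sigma(k)}c_{\sigma(k+1)}}$ (the convex hull of their pairwise intersection points), and the triple $(b_{\sigma(k)},b_{\sigma(k+1)},d_{\sigma(k)})$ has positive orientation. A configuration in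 $\mathcal{F}_\sigma$ is called a star configuration if every cyclically consecutive triple of $\sigma$ is positively signed, that is, for every $k\in[n]$ the number of pairs $\{i,j\}\subset\{k,k+1,k+2\}$ (indices reduced modulo $n$ to $[n]$) with $i<j$ and $\sigma(i)>\sigma(j)$ is even. Theorem. No star configuration can be realized with its extreme points on a conic: if $P$ is a star configuration and $Q\subset\mathbb{R}^2$ has the same order type as $P$, then there is no conic (zero set of a real polynomial of degree exactly $2$ in two variables, possibly degenerate) that contains all extreme points of $Q$. -/

import Mathlib

namespace StarConfig

/-- The real affine plane. -/
abbrev Plane : Type := ℝ × ℝ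

/-- The orientation of an ordered triple of points: positive for a counterclockwise triple,
negative for a clockwise one, and zero for a collinear one. -/
noncomputable def orientation (p q r : Plane) : SignType :=
  SignType.sign (Matrix.det !![p.1, q.1, r.1; p.2, q.2, r.2; 1, 1, 1])

/-- Two point sets have the same order type when some bijection between them preserves the
orientation of every ordered triple. -/
def SameOrderType (P Q : Set Plane) : Prop :=
  ∃ e : P ≃ Q, ∀ x y z : P,
    orientation (e x : Plane) (e y : Plane) (e z : Plane) = orientation (x : Plane) y z

/-- The extreme points of a configuration: the vertices of its convex hull. -/
def extremePts (P : Set Plane) : Set Plane := (convexHull ℝ P).extremePoints ℝ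

/-- A conic: the zero set of a real polynomial of degree two in two variables. Degenerate
conics are allowed. -/
def IsConic (γ : Set Plane) : Prop :=
  ∃ A B C D E F : ℝ, (A ≠ 0 ∨ B ≠ 0 ∨ C ≠ 0) ∧
    γ = {p | A * p.1 ^ 2 + B * (p.1 * p.2) + C * p.2 ^ 2 + D * p.1 + E * p.2 + F = 0}

/-- The configuration `P` can be realized with its extreme points on a conic: some point set
with the same order type has all of its extreme points on a conic. -/
def RealizableWithExtremePtsOnConic (P : Set Plane) : Prop :=
  ∃ Q : Set Plane, SameOrderType P Q ∧ ∃ γ : Set Plane, IsConic γ ∧ extremePts Q ⊆ γ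

/-- The points `a₁, b₁, c₁, a₂, b₂, c₂, …, aₙ, bₙ, cₙ` as one sequence: the index set is
`Fin n × Fin 3` in the lexicographic order. -/
def interleave {n : ℕ} (a b c : Fin n → Plane) (i : Fin n ×ₗ Fin 3) : Plane :=
  ![a (ofLex i).1, b (ofLex i).1, c (ofLex i).1] (ofLex i).2

/-- The points `v i` are in convex position and appear in counterclockwise order along the
boundary of their convex hull. -/
def CounterclockwiseConvexPosition {ι : Type*} [LinearOrder ι] (v : ι → Plane) : Prop :=
  ConvexIndependent ℝ v ∧ ∀ i j k : ι, i < j → j < k → orientation (v i) (v j) (v k) = 1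

/-- The (closed) triangle formed by three pairwise intersecting lines: the convex hull of their
pairwise intersection points. -/
def triangleOfLines (l₁ l₂ l₃ : AffineSubspace ℝ Plane) : Set Plane :=
  convexHull ℝ (((l₁ : Set Plane) ∩ l₂) ∪ ((l₂ : Set Plane) ∩ l₃) ∪ ((l₁ : Set Plane) ∩ l₃))

/-- The family of configurations `{aₖ, bₖ, cₖ, dₖ}` attached to a permutation `σ`: the points
`a₁, b₁, c₁, …, aₙ, bₙ, cₙ` are in convex position in this counterclockwise order, and for each
`k`, taken modulo `n`, the point `d (σ k)` lies in the triangle formed by the lines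
`a (σ k) a (σ (k + 1))`, `b (σ k) b (σ (k + 1))` and `c (σ k) c (σ (k + 1))`, strictly to the
left of the directed line from `b (σ k)` to `b (σ (k + 1))`. -/
def family {n : ℕ} [NeZero n] (σ : Equiv.Perm (Fin n)) : Set (Set Plane) :=
  {P | ∃ a b c d : Fin n → Plane,
    P = Set.range a ∪ Set.range b ∪ Set.range c ∪ Set.range d ∧
    CounterclockwiseConvexPosition (interleave a b c) ∧
    ∀ k : Fin n,
      d (σ k) ∈ triangleOfLines
        (line[ℝ, a (σ k), a (σ (k + 1))])
        (line[ℝ, b (σ k), b (σ (k + 1))])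
        (line[ℝ, c (σ k), c (σ (k + 1))]) ∧
      orientation (b (σ k)) (b (σ (k + 1))) (d (σ k)) = 1}

/-- The number of inversions of `σ` among the positions `k, k + 1, k + 2` modulo `n`. -/
def tripleInversions {n : ℕ} [NeZero n] (σ : Equiv.Perm (Fin n)) (k : Fin n) : ℕ :=
  Finset.card {p : Fin n × Fin n |
    p.1 ∈ ({k, k + 1, k + 2} : Finset (Fin n)) ∧ p.2 ∈ ({k, k + 1, k + 2} : Finset (Fin n)) ∧
      p.1 < p.2 ∧ σ p.2 < σ p.1}

/-- Every cyclically consecutive triple `(σ k, σ (k + 1), σ (k + 2))` is positively signed. -/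
def ConsecutiveTriplesPositive {n : ℕ} [NeZero n] (σ : Equiv.Perm (Fin n)) : Prop :=
  ∀ k : Fin n, (-1 : ℤ) ^ tripleInversions σ k = 1

/-- A star configuration, with parameter `n`: a member of the family of a permutation all
of whose consecutive triples are positively signed. -/
def IsStarConfiguration (n : ℕ) [NeZero n] (P : Set Plane) : Prop :=
  ∃ σ : Equiv.Perm (Fin n), ConsecutiveTriplesPositive σ ∧ P ∈ family σ

end StarConfig

/-!
The signs that define a star configuration are conditions on the order type alone: for consecutive
groups `i = σ k` and `j = σ (k + 1)` the point `d i` lies strictly to the left of the chord `b i b j`,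
weakly to the right of the chords `a i a j` and `c i c j` (`area_outer_chords_nonpos`), and strictly
to the left of `a i c i` (`area_first_last_pos`). The points `a`, `b`, `c` also stay extreme in every
realization of the order type (`image_mem_extremePts`). So it is enough to show that points
`a`, `b`, `c` on a conic, in convex position, admit no points `d` with these signs.

Projecting the conic from its first point turns `a`, `b`, `c` into plane vectors in angular order,
and the position of a point `d` relative to the chord with parameters `u`, `v` becomes
`bracket u v` times a symmetric bilinear form in `u` and `v` (`exists_parametrization`). Rescale so
that group `i` becomes a unimodular frame `(x i, y i)` with `b i` proportional to `x i + y i`. The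
existence of `d i` with the signs above then says that the matrix in `SL₂(ℝ)` which carries the
frame `i` to the frame `j` has negative trace, once the vectors of group `j` are turned so that they
follow those of group `i` (`bracket_lt_bracket_of_polarForm`). That is,
`bracket (x i) (y j) < bracket (y i) (x j)`.

Put `s i j = bracket (y i) (x j) / bracket (x i) (x j)`. The trace inequality bounds `s i j` below by
`bracket (x i) (y j) / bracket (x i) (x j)`, and for a counterclockwise triple `(i, j, l)` the
Plücker relation shows that this exceeds `s j l` (`bracket_div_lt_bracket_div`). Since all
consecutive triples of `σ` are counterclockwise, `s (σ k) (σ (k + 1))` decreases strictly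
along a closed cycle, which is absurd.
-/

namespace StarConfig

/-! ### Brackets and oriented areas -/

/-- The determinant of two plane vectors. -/
def bracket (u v : Plane) : ℝ := u.1 * v.2 - u.2 * v.1

/-- Twice the signed area of a triangle: the determinant whose sign is the orientation. -/
def area (p q r : Plane) : ℝ :=
  (q.1 - p.1) * (r.2 - p.2) - (q.2 - p.2) * (r.1 - p.1)

/-- The symmetric bilinear form on the plane with Gram matrix `!![e, f; f, g]`. -/
def polarForm (e f g : ℝ) (u v : Plane) : ℝ :=
  e * (u.1 * v.1) + f * (u.1 * v.2 + u.2 * v.1) + g * (u.2 * v.2)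

/-- The binary quadratic form with coefficients `A`, `B`, `C`. -/
def quadForm (A B C : ℝ) (w : Plane) : ℝ := A * w.1 ^ 2 + B * (w.1 * w.2) + C * w.2 ^ 2

theorem orientation_eq_sign_area (p q r : Plane) :
    orientation p q r = SignType.sign (area p q r) := by
  unfold orientation area
  congr 1
  rw [Matrix.det_fin_three]
  simp
  ring

theorem orientation_eq_one_iff {p q r : Plane} : orientation p q r = 1 ↔ 0 < area p q r := by
  rw [orientation_eq_sign_area, sign_eq_one_iff]

theorem orientation_nonneg_iff {p q r : Plane} : 0 ≤ orientation p q r ↔ 0 ≤ area p q r := by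
  rw [orientation_eq_sign_area, sign_nonneg_iff]

theorem orientation_nonpos_iff {p q r : Plane} : orientation p q r ≤ 0 ↔ area p q r ≤ 0 := by
  rw [orientation_eq_sign_area, sign_nonpos_iff]

theorem area_rotate (p q r : Plane) : area q r p = area p q r := by
  unfold area; ring

theorem area_swap (p q r : Plane) : area p r q = - area p q r := by
  unfold area; ring

theorem area_self_left (p q : Plane) : area p q p = 0 := by
  unfold area; ring

theorem area_self_right (p q : Plane) : area p q q = 0 := by
  unfold area; ring

theorem bracket_sub_eq_area (o p q : Plane) : bracket (p - o) (q - o) = area o p q := by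
  simp only [bracket, area, Prod.fst_sub, Prod.snd_sub]

theorem bracket_swap (u v : Plane) : bracket v u = - bracket u v := by
  unfold bracket; ring

theorem bracket_smul_smul (a b : ℝ) (p q : Plane) :
    bracket (a • p) (b • q) = a * b * bracket p q := by
  simp [bracket]; ring

theorem polarForm_smul_smul (e f g a b : ℝ) (p q : Plane) :
    polarForm e f g (a • p) (b • q) = a * b * polarForm e f g p q := by
  simp [polarForm]; ring

/-! ### Rational parametrization of a conic -/

/-- If the conic point `p` is the image of the parameter `u` under the projection from the
conic point `o`, and likewise `q` of `v`, then the line `pq` evaluated at `d` is, up to the factor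
`bracket u v` and the weights of the parametrization, a symmetric bilinear form in `u` and `v`. -/
theorem area_mul_quadForm_mul_quadForm (A B C l m : ℝ) (o d : Plane) :
    ∃ e f g : ℝ, ∀ p q u v : Plane,
      quadForm A B C u * (p.1 - o.1) = -(l * u.1 + m * u.2) * u.1 →
      quadForm A B C u * (p.2 - o.2) = -(l * u.1 + m * u.2) * u.2 →
      quadForm A B C v * (q.1 - o.1) = -(l * v.1 + m * v.2) * v.1 →
      quadForm A B C v * (q.2 - o.2) = -(l * v.1 + m * v.2) * v.2 →
      area p q d * (quadForm A B C u * quadForm A B C v) =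
        bracket u v * polarForm e f g u v := by
  -- The quadratic form `(l u₁ + m u₂) * bracket u (d - o)` has coefficients
  -- `l δ₂`, `m δ₂ - l δ₁`, `-m δ₁` with `δ = d - o`.
  refine ⟨l ^ 2 - (A * (m * (d.2 - o.2) - l * (d.1 - o.1)) - B * (l * (d.2 - o.2))),
    l * m - (A * (-(m * (d.1 - o.1))) - C * (l * (d.2 - o.2))),
    m ^ 2 - (B * (-(m * (d.1 - o.1))) - C * (m * (d.2 - o.2) - l * (d.1 - o.1))), ?_⟩
  intro p q u v h1 h2 h3 h4
  set U := quadForm A B C u with hU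
  set V := quadForm A B C v with hV
  have key : area p q d * (U * V) =
      (U * (p.1 - o.1)) * (V * (q.2 - o.2)) - (U * (p.2 - o.2)) * (V * (q.1 - o.1))
      + U * ((V * (q.1 - o.1)) * (d.2 - o.2) - (V * (q.2 - o.2)) * (d.1 - o.1))
      - V * ((U * (p.1 - o.1)) * (d.2 - o.2) - (U * (p.2 - o.2)) * (d.1 - o.1)) := by
    unfold area; ring
  rw [key, h1, h2, h3, h4, hU, hV]
  unfold quadForm bracket polarForm
  ring

/-- The Vandermonde identity for three points of a conic through `o`; the discriminant
`quadForm A B C (-m, l)` vanishes for degenerate conics. -/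
theorem area_mul_quadForm_triple {A B C l m : ℝ} {o p q r : Plane}
    (hp : quadForm A B C (p - o) = -(l * (p - o).1 + m * (p - o).2))
    (hq : quadForm A B C (q - o) = -(l * (q - o).1 + m * (q - o).2))
    (hr : quadForm A B C (r - o) = -(l * (r - o).1 + m * (r - o).2)) :
    quadForm A B C (p - o) * quadForm A B C (q - o) * quadForm A B C (r - o) * area p q r =
      quadForm A B C (-m, l) *
        (bracket (p - o) (q - o) * bracket (q - o) (r - o) * bracket (p - o) (r - o)) := by
  have key : area p q r =
      bracket (p - o) (q - o) + bracket (q - o) (r - o) - bracket (p - o) (r - o) := by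
    simp only [area, bracket, Prod.fst_sub, Prod.snd_sub]; ring
  rw [key]
  generalize p - o = u at *
  generalize q - o = v at *
  generalize r - o = w at *
  have h : quadForm A B C u * quadForm A B C v * quadForm A B C w *
        (bracket u v + bracket v w - bracket u w) =
      (l * u.1 + m * u.2) * (l * v.1 + m * v.2) * quadForm A B C w * bracket u v
      + (l * v.1 + m * v.2) * (l * w.1 + m * w.2) * quadForm A B C u * bracket v w
      - (l * u.1 + m * u.2) * (l * w.1 + m * w.2) * quadForm A B C v * bracket u w := by
    have h1 := congrArg₂ (· * ·) hp hq
    have h2 := congrArg₂ (· * ·) hq hr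
    have h3 := congrArg₂ (· * ·) hp hr
    linear_combination quadForm A B C w * bracket u v * h1 + quadForm A B C u * bracket v w * h2
      - quadForm A B C v * bracket u w * h3
  rw [h]
  unfold quadForm bracket
  ring

/-- A binary quadratic form with three pairwise non-proportional zeros vanishes. -/
theorem quadForm_eq_zero_of_three {A B C : ℝ} {u v w : Plane}
    (hu : quadForm A B C u = 0) (hv : quadForm A B C v = 0) (hw : quadForm A B C w = 0)
    (huv : bracket u v ≠ 0) (hvw : bracket v w ≠ 0) (huw : bracket u w ≠ 0) :
    A = 0 ∧ B = 0 ∧ C = 0 := by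
  have h := mul_ne_zero (mul_ne_zero huv hvw) huw
  unfold quadForm at hu hv hw
  refine ⟨?_, ?_, ?_⟩ <;> refine (mul_eq_zero.1 (?_ : _ * (_ : ℝ) = 0)).resolve_right h <;>
    unfold bracket
  · linear_combination (v.1 * w.2 - v.2 * w.1) * v.2 * w.2 * hu
      - (u.1 * w.2 - u.2 * w.1) * u.2 * w.2 * hv + (u.1 * v.2 - u.2 * v.1) * u.2 * v.2 * hw
  · linear_combination - (v.1 * w.2 - v.2 * w.1) * (v.1 * w.2 + v.2 * w.1) * hu
      + (u.1 * w.2 - u.2 * w.1) * (u.1 * w.2 + u.2 * w.1) * hv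
      - (u.1 * v.2 - u.2 * v.1) * (u.1 * v.2 + u.2 * v.1) * hw
  · linear_combination (v.1 * w.2 - v.2 * w.1) * v.1 * w.1 * hu
      - (u.1 * w.2 - u.2 * w.1) * u.1 * w.1 * hv + (u.1 * v.2 - u.2 * v.1) * u.1 * v.1 * hw

/-- A symmetric ternary relation holds for all triples of distinct elements as soon as it holds for
the increasing ones. -/
theorem ternary_of_sorted {ι : Type*} [LinearOrder ι] {R : ι → ι → ι → Prop}
    (h12 : ∀ i j k, R i j k → R j i k) (h23 : ∀ i j k, R i j k → R i k j)
    (h : ∀ i j k, i < j → j < k → R i j k) {i j k : ι} (hij : i ≠ j) (hjk : j ≠ k) (hik : i ≠ k) :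
    R i j k := by
  rcases hij.lt_or_gt with h1 | h1 <;> rcases hjk.lt_or_gt with h2 | h2 <;>
    rcases hik.lt_or_gt with h3 | h3
  · exact h _ _ _ h1 h2
  · exact h _ _ _ h1 h2
  · exact h23 _ _ _ (h _ _ _ h3 h2)
  · exact h23 _ _ _ (h12 _ _ _ (h _ _ _ h3 h1))
  · exact h12 _ _ _ (h _ _ _ h1 h3)
  · exact h12 _ _ _ (h23 _ _ _ (h _ _ _ h2 h3))
  · exact absurd (h2.trans h1) h3.not_gt
  · exact h12 _ _ _ (h23 _ _ _ (h12 _ _ _ (h _ _ _ h2 h1)))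

theorem area_ne_zero_of_ccw {ι : Type*} [LinearOrder ι] {v : ι → Plane}
    (hv : ∀ i j k, i < j → j < k → 0 < area (v i) (v j) (v k))
    {i j k : ι} (hij : i ≠ j) (hjk : j ≠ k) (hik : i ≠ k) : area (v i) (v j) (v k) ≠ 0 :=
  ternary_of_sorted (R := fun i j k => area (v i) (v j) (v k) ≠ 0)
    (fun i j k h => by rwa [← area_rotate, area_swap, neg_ne_zero])
    (fun i j k h => by rwa [area_swap, neg_ne_zero])
    (fun i j k h1 h2 => (hv i j k h1 h2).ne') hij hjk hik

section Parametrization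

variable {ι : Type*} [LinearOrder ι] [Fintype ι] {v : ι → Plane} {A B C l m : ℝ} {z : ι}

/-- When the quadratic part of the equation is positive along all chords from the first point `v z`,
the parameters are the chord vectors `v i - v z`, completed by a tangent vector at `v z`. -/
theorem exists_parametrization_of_pos (hz : ∀ i, z ≤ i)
    (hcard : 4 ≤ Fintype.card ι)
    (hv : ∀ i j k, i < j → j < k → 0 < area (v i) (v j) (v k))
    (hq : ∀ i, quadForm A B C (v i - v z) = -(l * (v i - v z).1 + m * (v i - v z).2))
    (hpos : ∀ i, i ≠ z → 0 < quadForm A B C (v i - v z)) :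
    ∃ u : ι → Plane, (∀ i j, i < j → 0 < bracket (u i) (u j)) ∧
      ∃ w : ι → ℝ, (∀ i, 0 < w i) ∧ ∀ d : Plane, ∃ e f g : ℝ, ∀ i j,
        area (v i) (v j) d * (w i * w j) = bracket (u i) (u j) * polarForm e f g (u i) (u j) := by
  have hlt : ∀ {i}, i ≠ z → z < i := fun {i} h => lt_of_le_of_ne (hz i) h.symm
  have hbr : ∀ {i j}, i ≠ z → i < j → 0 < bracket (v i - v z) (v j - v z) := fun {i j} hi hij => by
    rw [bracket_sub_eq_area]; exact hv _ _ _ (hlt hi) hij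
  have hC : 0 < quadForm A B C (-m, l) := by
    have h3 : 2 < (Finset.univ.erase z).card := by
      rw [Finset.card_erase_of_mem (Finset.mem_univ z), Finset.card_univ]; omega
    obtain ⟨i, hi, j, hj, k, hk, hij, hik, hjk⟩ := Finset.two_lt_card.1 h3
    refine ternary_of_sorted
      (R := fun i j k => i ≠ z → j ≠ z → k ≠ z → 0 < quadForm A B C (-m, l))
      (fun i j k h a b c => h b a c) (fun i j k h a b c => h a c b) ?_ hij hjk hik
      (Finset.ne_of_mem_erase hi) (Finset.ne_of_mem_erase hj) (Finset.ne_of_mem_erase hk)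
    intro i j k hij hjk hi hj hk
    have h := area_mul_quadForm_triple (hq i) (hq j) (hq k)
    have h1 := mul_pos (mul_pos (mul_pos (hpos i hi) (hpos j hj)) (hpos k hk)) (hv i j k hij hjk)
    rw [h] at h1
    exact pos_of_mul_pos_left h1
      (mul_pos (mul_pos (hbr hi hij) (hbr hj hjk)) (hbr hi (hij.trans hjk))).le
  classical
  let u : ι → Plane := fun i => if i = z then (-m, l) else v i - v z
  have huz : u z = (-m, l) := if_pos rfl
  have hu : ∀ {i}, i ≠ z → u i = v i - v z := fun {i} h => if_neg h
  refine ⟨u, ?_, fun i => quadForm A B C (u i), ?_, ?_⟩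
  · intro i j hij
    have hj : j ≠ z := ((hz i).trans_lt hij).ne'
    by_cases hi : i = z
    · subst hi
      rw [huz, hu hj]
      have h1 := hpos j hj
      rw [hq j] at h1
      unfold bracket
      linarith
    · rw [hu hi, hu hj]; exact hbr hi hij
  · intro i
    by_cases hi : i = z
    · subst hi; simpa only [huz] using hC
    · simpa only [hu hi] using hpos i hi
  · intro d
    obtain ⟨e, f, g, h⟩ := area_mul_quadForm_mul_quadForm A B C l m (v z) d
    refine ⟨e, f, g, fun i j => ?_⟩
    have h1 : ∀ i, quadForm A B C (u i) * ((v i).1 - (v z).1)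
          = -(l * (u i).1 + m * (u i).2) * (u i).1 ∧
        quadForm A B C (u i) * ((v i).2 - (v z).2)
          = -(l * (u i).1 + m * (u i).2) * (u i).2 := by
      intro i
      by_cases hi : i = z
      · subst hi; rw [huz]; constructor <;> ring
      · rw [hu hi, hq i]; exact ⟨rfl, rfl⟩
    exact h _ _ _ _ (h1 i).1 (h1 i).2 (h1 j).1 (h1 j).2

/-- Points of a conic in convex position lie on one side of the tangent at one of them. Six points
suffice to exclude degenerate conics and points on both branches of a hyperbola. -/
theorem quadForm_same_sign (hz : ∀ i, z ≤ i)
    (hcard : 6 ≤ Fintype.card ι)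
    (hv : ∀ i j k, i < j → j < k → 0 < area (v i) (v j) (v k))
    (hABC : A ≠ 0 ∨ B ≠ 0 ∨ C ≠ 0)
    (hq : ∀ i, quadForm A B C (v i - v z) = -(l * (v i - v z).1 + m * (v i - v z).2)) :
    (∀ i, i ≠ z → 0 < quadForm A B C (v i - v z)) ∨
      (∀ i, i ≠ z → quadForm A B C (v i - v z) < 0) := by
  classical
  have hbr0 : ∀ {i j}, i ≠ z → j ≠ z → i ≠ j → bracket (v i - v z) (v j - v z) ≠ 0 :=
    fun {i j} hi hj hij => by
      rw [bracket_sub_eq_area]; exact area_ne_zero_of_ccw hv hi.symm hij hj.symm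
  set S := Finset.univ.erase z with hS
  have hScard : 5 ≤ S.card := by
    rw [hS, Finset.card_erase_of_mem (Finset.mem_univ z), Finset.card_univ]; omega
  have hmem : ∀ {i}, i ∈ S → i ≠ z := fun h => Finset.ne_of_mem_erase h
  -- At most two of the chords from `v z` lie on the conic, so at least three do not.
  have hzero : (S.filter fun i => quadForm A B C (v i - v z) = 0).card ≤ 2 := by
    by_contra! h
    obtain ⟨i, hi, j, hj, k, hk, hij, hik, hjk⟩ := Finset.two_lt_card.1 h
    rw [Finset.mem_filter] at hi hj hk
    obtain ⟨h1, h2, h3⟩ := quadForm_eq_zero_of_three hi.2 hj.2 hk.2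
      (hbr0 (hmem hi.1) (hmem hj.1) hij) (hbr0 (hmem hj.1) (hmem hk.1) hjk)
      (hbr0 (hmem hi.1) (hmem hk.1) hik)
    tauto
  have hnonzero : 2 < (S.filter fun i => ¬ quadForm A B C (v i - v z) = 0).card := by
    have := Finset.card_filter_add_card_filter_not (s := S)
      (fun i => quadForm A B C (v i - v z) = 0)
    omega
  have hC : quadForm A B C (-m, l) ≠ 0 := by
    obtain ⟨i, hi, j, hj, k, hk, hij, hik, hjk⟩ := Finset.two_lt_card.1 hnonzero
    rw [Finset.mem_filter] at hi hj hk
    have h := area_mul_quadForm_triple (hq i) (hq j) (hq k)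
    exact left_ne_zero_of_mul
      (h ▸ mul_ne_zero (mul_ne_zero (mul_ne_zero hi.2 hj.2) hk.2)
        (area_ne_zero_of_ccw hv hij hjk hik))
  have htriple : ∀ {i j k}, i ≠ j → j ≠ k → i ≠ k → i ≠ z → j ≠ z → k ≠ z →
      0 < quadForm A B C (-m, l) * (quadForm A B C (v i - v z) * quadForm A B C (v j - v z) *
        quadForm A B C (v k - v z)) := by
    intro i j k hij hjk hik
    refine ternary_of_sorted (R := fun i j k => i ≠ z → j ≠ z → k ≠ z →
      0 < quadForm A B C (-m, l) * (quadForm A B C (v i - v z) * quadForm A B C (v j - v z) *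
        quadForm A B C (v k - v z)))
      (fun i j k h a b c => by linarith [h b a c]) (fun i j k h a b c => by linarith [h a c b])
      ?_ hij hjk hik
    intro i j k hij hjk hi hj hk
    have h := area_mul_quadForm_triple (hq i) (hq j) (hq k)
    have hb : ∀ {i j}, i ≠ z → i < j → 0 < bracket (v i - v z) (v j - v z) :=
      fun {i j} hi hij => by
        rw [bracket_sub_eq_area]; exact hv _ _ _ (lt_of_le_of_ne (hz i) hi.symm) hij
    refine pos_of_mul_pos_left ?_ (hv i j k hij hjk).le
    rw [mul_assoc, h, ← mul_assoc]
    exact mul_pos (mul_self_pos.2 hC)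
      (mul_pos (mul_pos (hb hi hij) (hb hj hjk)) (hb hi (hij.trans hjk)))
  have hpair : ∀ {i j}, i ≠ z → j ≠ z → i ≠ j →
      0 < quadForm A B C (v i - v z) * quadForm A B C (v j - v z) := by
    intro i j hi hj hij
    have h2 : 1 < ((S.erase i).erase j).card := by
      have := Finset.pred_card_le_card_erase (s := S) (a := i)
      have := Finset.pred_card_le_card_erase (s := S.erase i) (a := j)
      omega
    obtain ⟨a, ha, b, hb, hab⟩ := Finset.one_lt_card.1 h2
    simp only [Finset.mem_erase] at ha hb
    have haz := hmem ha.2.2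
    have hbz := hmem hb.2.2
    have h := mul_pos (htriple hab hb.2.1 ha.2.1 haz hbz hi) (htriple hab hb.1 ha.1 haz hbz hj)
    refine pos_of_mul_pos_left (b := (quadForm A B C (-m, l) *
      (quadForm A B C (v a - v z) * quadForm A B C (v b - v z))) ^ 2) ?_ (sq_nonneg _)
    linarith
  obtain ⟨i, hi⟩ : S.Nonempty := Finset.card_pos.1 (by omega)
  obtain ⟨j, hj⟩ : (S.erase i).Nonempty := Finset.card_pos.1 (by
    have := Finset.pred_card_le_card_erase (s := S) (a := i)
    omega)
  rw [Finset.mem_erase] at hj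
  have hi0 : quadForm A B C (v i - v z) ≠ 0 :=
    left_ne_zero_of_mul (hpair (hmem hi) (hmem hj.2) hj.1.symm).ne'
  rcases hi0.lt_or_gt with h | h
  · refine Or.inr fun k hk => ?_
    by_cases hki : k = i
    · rwa [hki]
    · exact neg_of_mul_pos_left (hpair hk (hmem hi) hki) h.le
  · refine Or.inl fun k hk => ?_
    by_cases hki : k = i
    · rwa [hki]
    · exact pos_of_mul_pos_left (hpair hk (hmem hi) hki) h.le

/-- At least six points of a conic in counterclockwise convex position are parametrized, in that
order, by vectors in an open half-plane, in such a way that the position of a point `d` relative to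
the chords is given by a symmetric bilinear form. -/
theorem exists_parametrization {D E F : ℝ} (hcard : 6 ≤ Fintype.card ι)
    (hv : ∀ i j k, i < j → j < k → 0 < area (v i) (v j) (v k))
    (hABC : A ≠ 0 ∨ B ≠ 0 ∨ C ≠ 0)
    (hconic : ∀ i, A * (v i).1 ^ 2 + B * ((v i).1 * (v i).2) + C * (v i).2 ^ 2
      + D * (v i).1 + E * (v i).2 + F = 0) :
    ∃ u : ι → Plane, (∀ i j, i < j → 0 < bracket (u i) (u j)) ∧
      ∃ w : ι → ℝ, (∀ i, 0 < w i) ∧ ∀ d : Plane, ∃ e f g : ℝ, ∀ i j,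
        area (v i) (v j) d * (w i * w j) = bracket (u i) (u j) * polarForm e f g (u i) (u j) := by
  have : Nonempty ι := Fintype.card_pos_iff.1 (by omega)
  obtain ⟨z, hz⟩ : ∃ z : ι, ∀ i, z ≤ i := Finite.exists_min (id : ι → ι)
  -- The linear part of the equation at the base point `v z`.
  set l := 2 * A * (v z).1 + B * (v z).2 + D with hl
  set m := B * (v z).1 + 2 * C * (v z).2 + E with hm
  have hq : ∀ i, quadForm A B C (v i - v z) = -(l * (v i - v z).1 + m * (v i - v z).2) := by
    intro i
    simp only [quadForm, Prod.fst_sub, Prod.snd_sub, hl, hm]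
    linear_combination hconic i - hconic z
  rcases quadForm_same_sign hz hcard hv hABC hq with h | h
  · exact exists_parametrization_of_pos hz (by omega) hv hq h
  · have hneg : ∀ w, quadForm (-A) (-B) (-C) w = - quadForm A B C w := fun w => by
      unfold quadForm; ring
    refine exists_parametrization_of_pos (A := -A) (B := -B) (C := -C) (l := -l) (m := -m)
      hz (by omega) hv (fun i => ?_) (fun i hi => ?_)
    · rw [hneg, hq]; ring
    · rw [hneg]; linarith [h i hi]

end Parametrization

/-! ### Two groups of three points: a trace inequality -/

/-- Three vectors in angular order can be rescaled so that the outer ones form a unimodular frame and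
the middle one becomes their sum. -/
theorem exists_normalized_frame {a b c : Plane} (hab : 0 < bracket a b) (hbc : 0 < bracket b c)
    (hac : 0 < bracket a c) :
    ∃ α β μ : ℝ, 0 < α ∧ 0 < β ∧ 0 < μ ∧ α • a + β • c = μ • b ∧ α * β * bracket a c = 1 := by
  set p := bracket a b with hp
  set q := bracket b c with hq
  set r := bracket a c with hr
  -- The linear relation between the three vectors is `q a + p c = r b`.
  have hs : 0 < √(p * q * r) := Real.sqrt_pos.2 (by positivity)
  have hss : √(p * q * r) * √(p * q * r) = p * q * r := Real.mul_self_sqrt (by positivity)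
  refine ⟨q / √(p * q * r), p / √(p * q * r), r / √(p * q * r), by positivity, by positivity,
    by positivity, ?_, ?_⟩
  · ext
    · simp only [Prod.fst_add, Prod.smul_fst, smul_eq_mul, hp, hq, hr, bracket]
      field_simp
      ring
    · simp only [Prod.snd_add, Prod.smul_snd, smul_eq_mul, hp, hq, hr, bracket]
      field_simp
      ring
  · rw [div_mul_div_comm, hss]
    field_simp

/-- Let `M` be the element of `SL₂(ℝ)` carrying the frame `(x, y)` to `(x', y')`. The conclusion says
that `M` has negative trace. The hypotheses are what the position of a point relative to the chords
`x x'`, `y y'`, `(x + y) (x' + y')` and `x y` of a conic amounts to in terms of parameters. -/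
theorem bracket_lt_bracket_of_polarForm {x y x' y' : Plane} {e f g : ℝ}
    (hxy : bracket x y = 1) (hxy' : bracket x' y' = 1)
    (h1 : 0 < bracket x y') (h2 : 0 < bracket y x')
    (h3 : 0 < bracket x x') (h4 : 0 < bracket y y')
    (ha : polarForm e f g x x' ≤ 0) (hc : polarForm e f g y y' ≤ 0)
    (hb : 0 < polarForm e f g (x + y) (x' + y')) (hd : 0 < polarForm e f g x y) :
    bracket x y' < bracket y x' := by
  set α := bracket y x' with hα
  set δ := bracket x y' with hδ
  set β := bracket x x' with hβ
  set γ := bracket y y' with hγ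
  -- Coordinates of the second frame in the first.
  have hx' : x' = (-α) • x + β • y := by
    unfold bracket at hα hβ hxy
    ext
    · simp only [Prod.fst_add, Prod.smul_fst, smul_eq_mul, hα, hβ]
      linear_combination (-x'.1) * hxy
    · simp only [Prod.snd_add, Prod.smul_snd, smul_eq_mul, hα, hβ]
      linear_combination (-x'.2) * hxy
  have hy' : y' = (-γ) • x + δ • y := by
    unfold bracket at hγ hδ hxy
    ext
    · simp only [Prod.fst_add, Prod.smul_fst, smul_eq_mul, hγ, hδ]
      linear_combination (-y'.1) * hxy
    · simp only [Prod.snd_add, Prod.smul_snd, smul_eq_mul, hγ, hδ]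
      linear_combination (-y'.2) * hxy
  set p := polarForm e f g x x with hp
  set q := polarForm e f g x y with hq
  set r := polarForm e f g y y with hr
  have ea : polarForm e f g x x' = -α * p + β * q := by
    rw [hx', hp, hq]; simp [polarForm]; ring
  have ec : polarForm e f g y y' = -γ * q + δ * r := by
    rw [hy', hq, hr]; simp [polarForm]; ring
  have eb : polarForm e f g (x + y) (x' + y') =
      (-α * p + β * q) + (-γ * q + δ * r) + (-γ * p + (δ - α) * q + β * r) := by
    rw [hx', hy', hp, hq, hr]; simp [polarForm]; ring
  have hdet : β * γ = 1 + α * δ := by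
    rw [hx', hy'] at hxy'
    have : bracket ((-α) • x + β • y) ((-γ) • x + δ • y) = (β * γ - α * δ) * bracket x y := by
      simp [bracket]; ring
    rw [this, hxy] at hxy'
    linarith
  rw [ea] at ha
  rw [ec] at hc
  rw [eb] at hb
  have hmid : 0 < -γ * p + (δ - α) * q + β * r := by linarith
  -- Eliminating `p` and `r` leaves `(δ - α) * q < 0`.
  have e1 : 0 < α * δ * (-γ * p + (δ - α) * q + β * r) := by positivity
  have e2 : γ * δ * (-α * p + β * q) ≤ 0 := mul_nonpos_of_nonneg_of_nonpos (by positivity) ha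
  have e3 : α * β * (-γ * q + δ * r) ≤ 0 := mul_nonpos_of_nonneg_of_nonpos (by positivity) hc
  have e4 : 0 < (α - δ) * q := by
    have : α * δ * (-γ * p + (δ - α) * q + β * r) =
        γ * δ * (-α * p + β * q) + α * β * (-γ * q + δ * r)
          + (α - δ) * q * (β * γ - α * δ) := by ring
    rw [this, hdet] at e1
    linarith
  linarith [pos_of_mul_pos_left e4 hd.le]

theorem plucker (p q r s : Plane) :
    bracket p q * bracket r s - bracket p r * bracket q s = bracket p s * bracket r q := by
  unfold bracket; ring

/-! ### Cyclic triples and parity of inversions -/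

/-- `i`, `j`, `k` are distinct and appear in this cyclic order. -/
def CyclicOrdered {ι : Type*} [LT ι] (i j k : ι) : Prop :=
  (i < j ∧ j < k) ∨ (j < k ∧ k < i) ∨ (k < i ∧ i < j)

theorem CyclicOrdered.ne {ι : Type*} [Preorder ι] {i j k : ι} (h : CyclicOrdered i j k) :
    i ≠ j := by
  rcases h with h | h | h
  exacts [h.1.ne, (h.1.trans h.2).ne', h.2.ne]

theorem area_pos_of_cyclicOrdered {ι : Type*} [LinearOrder ι] {v : ι → Plane}
    (hv : ∀ i j k, i < j → j < k → 0 < area (v i) (v j) (v k)) {i j k : ι}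
    (h : CyclicOrdered i j k) : 0 < area (v i) (v j) (v k) := by
  rcases h with h | h | h
  · exact hv _ _ _ h.1 h.2
  · rw [← area_rotate]; exact hv _ _ _ h.1 h.2
  · rw [area_rotate (v k)]; exact hv _ _ _ h.1 h.2

/-- The inversions of `σ` among the positions in `s`, as increasing pairs of positions. -/
def inversionsOn {n : ℕ} (σ : Equiv.Perm (Fin n)) (s : Finset (Fin n)) :
    Finset (Fin n × Fin n) :=
  {p : Fin n × Fin n | p.1 ∈ s ∧ p.2 ∈ s ∧ p.1 < p.2 ∧ σ p.2 < σ p.1}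

theorem cyclicOrdered_of_even_of_lt {n : ℕ} (σ : Equiv.Perm (Fin n)) {x y z : Fin n}
    (hxy : x < y) (hyz : y < z)
    (he : Even (inversionsOn σ {x, y, z}).card) : CyclicOrdered (σ x) (σ y) (σ z) := by
  have hset : inversionsOn σ {x, y, z} =
      (({(x, y), (x, z), (y, z)} : Finset (Fin n × Fin n)).filter fun p => σ p.2 < σ p.1) := by
    ext ⟨p, q⟩
    simp only [inversionsOn, Finset.mem_filter, Finset.mem_univ, true_and, Finset.mem_insert,
      Finset.mem_singleton, Prod.mk.injEq]
    constructor
    · rintro ⟨rfl | rfl | rfl, rfl | rfl | rfl, h, h'⟩ <;>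
        first
        | (exfalso; order)
        | exact ⟨by simp, h'⟩
    · rintro ⟨⟨rfl, rfl⟩ | ⟨rfl, rfl⟩ | ⟨rfl, rfl⟩, h⟩ <;> refine ⟨by simp, by simp, ?_, h⟩ <;> order
  have h1 : σ x ≠ σ y := fun h => hxy.ne (σ.injective h)
  have h2 : σ y ≠ σ z := fun h => hyz.ne (σ.injective h)
  have h3 : σ x ≠ σ z := fun h => (hxy.trans hyz).ne (σ.injective h)
  have d1 : ((x, y) : Fin n × Fin n) ≠ (x, z) := fun h => hyz.ne (Prod.mk.inj h).2
  have d2 : ((x, y) : Fin n × Fin n) ≠ (y, z) := fun h => hxy.ne (Prod.mk.inj h).1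
  have d3 : ((x, z) : Fin n × Fin n) ≠ (y, z) := fun h => hxy.ne (Prod.mk.inj h).1
  rw [hset, Finset.filter_insert, Finset.filter_insert, Finset.filter_singleton] at he
  unfold CyclicOrdered
  rcases h1.lt_or_gt with a | a <;> rcases h2.lt_or_gt with b | b <;>
    rcases h3.lt_or_gt with c | c <;>
    simp only [a, b, c, a.not_gt, b.not_gt, c.not_gt, if_true, if_false] at he <;>
    first
    | (simp only [a, b, c]; simp; done)
    | (exfalso; order)
    | (exfalso; revert he; simp [d1, d2, d3]; done)
    | (exfalso; revert he
       rw [Finset.card_insert_of_notMem, Finset.card_insert_of_notMem] <;> simp [d1, d2, d3]; decide)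

theorem cyclicOrdered_of_even {n : ℕ} (σ : Equiv.Perm (Fin n)) {x y z : Fin n}
    (h : CyclicOrdered x y z) (he : Even (inversionsOn σ {x, y, z}).card) :
    CyclicOrdered (σ x) (σ y) (σ z) := by
  have hrot : ∀ {a b c : Fin n}, CyclicOrdered a b c → CyclicOrdered c a b := by
    unfold CyclicOrdered; tauto
  rcases h with h | h | h
  · exact cyclicOrdered_of_even_of_lt σ h.1 h.2 he
  · refine hrot (cyclicOrdered_of_even_of_lt σ h.1 h.2 ?_)
    have : ({x, y, z} : Finset (Fin n)) = {y, z, x} := by ext; simp; tauto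
    rwa [← this]
  · refine hrot (hrot (cyclicOrdered_of_even_of_lt σ h.1 h.2 ?_))
    have : ({x, y, z} : Finset (Fin n)) = {z, x, y} := by ext; simp; tauto
    rwa [← this]

theorem cyclicOrdered_consecutive {n : ℕ} [NeZero n] (hn : 3 ≤ n) (k : Fin n) :
    CyclicOrdered k (k + 1) (k + 2) := by
  obtain ⟨k, hk⟩ := k
  have e1 : ((1 : Fin n) : ℕ) = 1 := by
    rw [Fin.val_one', Nat.mod_eq_of_lt (by omega)]
  have e2 : ((2 : Fin n) : ℕ) = 2 := by
    exact Nat.mod_eq_of_lt (show 2 < n by omega)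
  simp only [CyclicOrdered, Fin.lt_def, Fin.val_add, e1, e2]
  rcases lt_trichotomy (k + 2) n with h | h | h
  · rw [Nat.mod_eq_of_lt h, Nat.mod_eq_of_lt (by omega)]; omega
  · rw [h, Nat.mod_self, Nat.mod_eq_of_lt (by omega)]; omega
  · have : k + 1 = n := by omega
    rw [this, Nat.mod_self, show k + 2 = n + 1 by omega, Nat.add_mod_left,
      Nat.mod_eq_of_lt (by omega)]
    omega

theorem ConsecutiveTriplesPositive.cyclicOrdered {n : ℕ} [NeZero n] (hn : 3 ≤ n)
    {σ : Equiv.Perm (Fin n)} (hσ : ConsecutiveTriplesPositive σ) (k : Fin n) :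
    CyclicOrdered (σ k) (σ (k + 1)) (σ (k + 2)) :=
  cyclicOrdered_of_even σ (cyclicOrdered_consecutive hn k)
    ((neg_one_pow_eq_one_iff_even (by norm_num)).1 (hσ k))

/-! ### Crossing chords and the triangles they form -/

theorem area_combo (p q x y : Plane) {a b : ℝ} (hab : a + b = 1) :
    area p q (a • x + b • y) = a * area p q x + b * area p q y := by
  obtain rfl : b = 1 - a := by linarith
  simp only [area, Prod.fst_add, Prod.snd_add, Prod.smul_fst, Prod.smul_snd, smul_eq_mul]
  ring

theorem convex_area_pos (p q : Plane) : Convex ℝ {x | 0 < area p q x} := by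
  intro x hx y hy a b ha hb hab
  simp only [Set.mem_ofPred_eq] at *
  rw [area_combo p q x y hab]
  rcases ha.eq_or_lt with rfl | ha
  · obtain rfl : b = 1 := by linarith
    linarith
  · linarith [mul_pos ha hx, mul_nonneg hb hy.le]

theorem convex_area_nonpos (p q : Plane) : Convex ℝ {x | area p q x ≤ 0} := by
  intro x hx y hy a b ha hb hab
  simp only [Set.mem_ofPred_eq] at *
  rw [area_combo p q x y hab]
  linarith [mul_nonpos_of_nonneg_of_nonpos ha hx, mul_nonpos_of_nonneg_of_nonpos hb hy]

theorem exists_eq_combo_of_mem_line {p q x : Plane} (hx : x ∈ line[ℝ, p, q]) :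
    ∃ t : ℝ, x = (1 - t) • p + t • q := by
  obtain ⟨t, rfl⟩ := mem_affineSpan_pair_iff_exists_lineMap_eq.1 hx
  exact ⟨t, AffineMap.lineMap_apply_module _ _ _⟩

theorem area_eq_zero_of_mem_line {p q x : Plane} (hx : x ∈ line[ℝ, p, q]) : area p q x = 0 := by
  obtain ⟨t, rfl⟩ := exists_eq_combo_of_mem_line hx
  rw [area_combo _ _ _ _ (by ring)]
  unfold area; ring

theorem mem_openSegment_of_mem_lines {p q p' q' x : Plane} (hx : x ∈ line[ℝ, p, q])
    (hx' : x ∈ line[ℝ, p', q']) (h : area p' q' p * area p' q' q < 0) :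
    x ∈ openSegment ℝ p q := by
  obtain ⟨t, rfl⟩ := exists_eq_combo_of_mem_line hx
  have h0 := area_eq_zero_of_mem_line hx'
  rw [area_combo _ _ _ _ (by ring)] at h0
  refine ⟨1 - t, t, ?_, ?_, by ring, rfl⟩
  · rcases mul_neg_iff.1 h with ⟨h1, h2⟩ | ⟨h1, h2⟩ <;> by_contra! ht <;>
      nlinarith
  · rcases mul_neg_iff.1 h with ⟨h1, h2⟩ | ⟨h1, h2⟩ <;> by_contra! ht <;>
      nlinarith

theorem area_pos_of_mem_openSegment {p q x y z : Plane} (hz : z ∈ openSegment ℝ x y)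
    (hx : 0 ≤ area p q x) (hy : 0 ≤ area p q y) (h : 0 < area p q x ∨ 0 < area p q y) :
    0 < area p q z := by
  obtain ⟨a, b, ha, hb, hab, rfl⟩ := hz
  rw [area_combo _ _ _ _ hab]
  rcases h with h | h
  · linarith [mul_pos ha h, mul_nonneg hb.le hy]
  · linarith [mul_pos hb h, mul_nonneg ha.le hx]

section Chords

variable {w w' : Fin 3 → Plane}

/-- The chords `w s, w' s` of a convex hexagon with vertices `w 0, w 1, w 2, w' 0, w' 1, w' 2`, in
this cyclic order, cross each other. -/
theorem area_chord_signs (h : ∀ s t u, s < t → 0 < area (w s) (w t) (w' u))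
    (h' : ∀ s t u, s < t → 0 < area (w' s) (w' t) (w u)) {s t : Fin 3} (hst : s < t) :
    area (w s) (w' s) (w t) < 0 ∧ 0 < area (w s) (w' s) (w' t) ∧
      0 < area (w t) (w' t) (w s) ∧ area (w t) (w' t) (w' s) < 0 := by
  have h1 := h s t s hst
  have h2 := h s t t hst
  have h3 := h' s t s hst
  have h4 := h' s t t hst
  unfold area at *
  refine ⟨?_, ?_, ?_, ?_⟩ <;> linarith

theorem mem_openSegment_chord (h : ∀ s t u, s < t → 0 < area (w s) (w t) (w' u))
    (h' : ∀ s t u, s < t → 0 < area (w' s) (w' t) (w u)) {s t : Fin 3} (hst : s ≠ t) {x : Plane}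
    (hx : x ∈ line[ℝ, w s, w' s]) (hx' : x ∈ line[ℝ, w t, w' t]) :
    x ∈ openSegment ℝ (w s) (w' s) := by
  refine mem_openSegment_of_mem_lines hx hx' ?_
  rcases hst.lt_or_gt with hst | hst
  · have := area_chord_signs h h' hst
    exact mul_neg_of_pos_of_neg this.2.2.1 this.2.2.2
  · have := area_chord_signs h h' hst
    exact mul_neg_of_neg_of_pos this.1 this.2.1

/-- The triangle of the three chords is contained in every convex set that contains the crossing
points of the chords. -/
theorem triangle_subset_of_convex (h : ∀ s t u, s < t → 0 < area (w s) (w t) (w' u))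
    (h' : ∀ s t u, s < t → 0 < area (w' s) (w' t) (w u)) {S : Set Plane} (hS : Convex ℝ S)
    (hcross : ∀ s t, s < t → ∀ x ∈ openSegment ℝ (w s) (w' s),
      x ∈ openSegment ℝ (w t) (w' t) → x ∈ S) :
    triangleOfLines (line[ℝ, w 0, w' 0]) (line[ℝ, w 1, w' 1]) (line[ℝ, w 2, w' 2]) ⊆ S := by
  refine convexHull_min ?_ hS
  have key : ∀ s t, s < t → ∀ x, x ∈ line[ℝ, w s, w' s] → x ∈ line[ℝ, w t, w' t] → x ∈ S :=
    fun s t hst x hx hx' => hcross s t hst x (mem_openSegment_chord h h' hst.ne hx hx')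
      (mem_openSegment_chord h h' hst.ne' hx' hx)
  rintro x ((⟨h1, h2⟩ | ⟨h1, h2⟩) | ⟨h1, h2⟩)
  · exact key 0 1 (by decide) x h1 h2
  · exact key 1 2 (by decide) x h1 h2
  · exact key 0 2 (by decide) x h1 h2

/-- A point of the triangle strictly to the left of the middle chord is weakly to the right of the
two outer ones. -/
theorem area_outer_chords_nonpos (h : ∀ s t u, s < t → 0 < area (w s) (w t) (w' u))
    (h' : ∀ s t u, s < t → 0 < area (w' s) (w' t) (w u)) {d : Plane}
    (hd : d ∈ triangleOfLines (line[ℝ, w 0, w' 0]) (line[ℝ, w 1, w' 1]) (line[ℝ, w 2, w' 2]))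
    (hb : 0 < area (w 1) (w' 1) d) :
    area (w 0) (w' 0) d ≤ 0 ∧ area (w 2) (w' 2) d ≤ 0 := by
  obtain ⟨s1, s2, s3, s4⟩ := area_chord_signs h h' (show (0 : Fin 3) < 1 by decide)
  obtain ⟨t1, t2, t3, t4⟩ := area_chord_signs h h' (show (1 : Fin 3) < 2 by decide)
  obtain ⟨r1, r2, r3, r4⟩ := area_chord_signs h h' (show (0 : Fin 3) < 2 by decide)
  -- The crossing point of the outer chords is to the left of the middle chord.
  obtain ⟨z, hz0, hz2, hz⟩ : ∃ z, z ∈ line[ℝ, w 0, w' 0] ∧ z ∈ line[ℝ, w 2, w' 2] ∧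
      0 < area (w 1) (w' 1) z := by
    by_contra! hno
    refine hb.not_ge (convexHull_min ?_ (convex_area_nonpos (w 1) (w' 1)) hd)
    rintro x ((⟨h1, h2⟩ | ⟨h1, h2⟩) | ⟨h1, h2⟩)
    · exact (area_eq_zero_of_mem_line h2).le
    · exact (area_eq_zero_of_mem_line h1).le
    · exact hno x h1 h2
  have hz0' := area_eq_zero_of_mem_line hz0
  have hz2' := area_eq_zero_of_mem_line hz2
  constructor
  · refine convexHull_min ?_ (convex_area_nonpos (w 0) (w' 0)) hd
    rintro x ((⟨h1, h2⟩ | ⟨h1, h2⟩) | ⟨h1, h2⟩)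
    · exact (area_eq_zero_of_mem_line h1).le
    · -- Along the third chord, both functionals increase, and `x` comes before `z`.
      have hx := area_eq_zero_of_mem_line h1
      obtain ⟨t, rfl⟩ := exists_eq_combo_of_mem_line h2
      obtain ⟨r, rfl⟩ := exists_eq_combo_of_mem_line hz2
      rw [area_combo _ _ _ _ (by ring)] at hx hz0' hz
      simp only [Set.mem_ofPred_eq]
      rw [area_combo _ _ _ _ (by ring)]
      have htr : t < r := by
        by_contra! hle
        nlinarith
      nlinarith
    · exact (area_eq_zero_of_mem_line h1).le
  · refine convexHull_min ?_ (convex_area_nonpos (w 2) (w' 2)) hd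
    rintro x ((⟨h1, h2⟩ | ⟨h1, h2⟩) | ⟨h1, h2⟩)
    · -- Along the first chord, both functionals decrease, and `x` comes after `z`.
      have hx := area_eq_zero_of_mem_line h2
      obtain ⟨t, rfl⟩ := exists_eq_combo_of_mem_line h1
      obtain ⟨r, rfl⟩ := exists_eq_combo_of_mem_line hz0
      rw [area_combo _ _ _ _ (by ring)] at hx hz2' hz
      simp only [Set.mem_ofPred_eq]
      rw [area_combo _ _ _ _ (by ring)]
      have htr : r < t := by
        by_contra! hle
        nlinarith
      nlinarith
    · exact (area_eq_zero_of_mem_line h2).le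
    · exact (area_eq_zero_of_mem_line h2).le

/-- The triangle lies on the inner side of the diagonal `w 0, w 2`. -/
theorem area_first_last_pos (h : ∀ s t u, s < t → 0 < area (w s) (w t) (w' u))
    (h' : ∀ s t u, s < t → 0 < area (w' s) (w' t) (w u)) {d : Plane}
    (hd : d ∈ triangleOfLines (line[ℝ, w 0, w' 0]) (line[ℝ, w 1, w' 1]) (line[ℝ, w 2, w' 2])) :
    0 < area (w 0) (w 2) d := by
  refine triangle_subset_of_convex h h' (convex_area_pos (w 0) (w 2)) ?_ hd
  intro s t hst x hx hx'
  have hs : s = 0 ∨ s = 2 ∨ t = 0 ∨ t = 2 := by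
    clear hx hx'
    revert s t; decide
  have key0 : x ∈ openSegment ℝ (w 0) (w' 0) → 0 < area (w 0) (w 2) x := fun hx =>
    area_pos_of_mem_openSegment hx (area_self_left _ _).ge (h 0 2 0 (by decide)).le
      (Or.inr (h 0 2 0 (by decide)))
  have key2 : x ∈ openSegment ℝ (w 2) (w' 2) → 0 < area (w 0) (w 2) x := fun hx =>
    area_pos_of_mem_openSegment hx (area_self_right _ _).ge (h 0 2 2 (by decide)).le
      (Or.inr (h 0 2 2 (by decide)))
  rcases hs with rfl | rfl | rfl | rfl
  exacts [key0 hx, key2 hx, key0 hx', key2 hx']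

end Chords

/-! ### Extreme points and order types -/

/-- A point of `Q` at which two supporting lines of `Q` meet, with no other point of `Q` on both, is
an extreme point of the convex hull. -/
theorem mem_extremePts_of_supporting {Q : Set Plane} {p x y : Plane} (hp : p ∈ Q)
    (h1 : ∀ q ∈ Q, 0 ≤ area x p q) (h2 : ∀ q ∈ Q, 0 ≤ area p y q)
    (h3 : ∀ q ∈ Q, area x p q ≤ 0 → area p y q ≤ 0 → q = p) : p ∈ extremePts Q := by
  -- The sum of the two functionals exposes `p`.
  set L : Plane → ℝ := fun q => area x p q + area p y q with hL
  have hLp : L p = 0 := by simp only [hL, area]; ring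
  have hLc : ∀ {a b : ℝ} (q r : Plane), a + b = 1 → L (a • q + b • r) = a * L q + b * L r := by
    intro a b q r hab
    simp only [hL]
    rw [area_combo _ _ _ _ hab, area_combo _ _ _ _ hab]
    ring
  have hconv : Convex ℝ {q | 0 < L q ∨ q = p} := by
    intro q hq r hr a b ha hb hab
    rcases ha.eq_or_lt with rfl | ha
    · obtain rfl : b = 1 := by linarith
      simpa using hr
    rcases hb.eq_or_lt with rfl | hb
    · obtain rfl : a = 1 := by linarith
      simpa using hq
    rcases hq with hq | rfl
    · left
      rw [hLc _ _ hab]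
      have : 0 ≤ L r := by
        rcases hr with hr | rfl
        exacts [hr.le, hLp.ge]
      linarith [mul_pos ha hq, mul_nonneg hb.le this]
    · rcases hr with hr | rfl
      · left
        rw [hLc _ _ hab, hLp]
        linarith [mul_pos hb hr]
      · right
        rw [← add_smul, hab, one_smul]
  have hsub : convexHull ℝ Q ⊆ {q | 0 < L q ∨ q = p} := by
    refine convexHull_min (fun q hq => ?_) hconv
    by_cases hqp : q = p
    · exact Or.inr hqp
    · left
      by_contra! hle
      have a1 := h1 q hq
      have a2 := h2 q hq
      exact hqp (h3 q hq (by simp only [hL] at hle; linarith) (by simp only [hL] at hle; linarith))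
  have hnn : ∀ {q}, (0 < L q ∨ q = p) → 0 ≤ L q := by
    rintro q (h | rfl)
    exacts [h.le, hLp.ge]
  refine mem_extremePoints.2 ⟨subset_convexHull ℝ Q hp, fun q hq r hr hpqr => ?_⟩
  obtain ⟨a, b, ha, hb, hab, hpe⟩ := hpqr
  have hL0 : a * L q + b * L r = 0 := by rw [← hLc _ _ hab, hpe, hLp]
  have hq' := hsub hq
  have hr' := hsub hr
  constructor
  · refine hq'.resolve_left fun hq0 => ?_
    linarith [mul_pos ha hq0, mul_nonneg hb.le (hnn hr')]
  · refine hr'.resolve_left fun hr0 => ?_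
    linarith [mul_pos hb hr0, mul_nonneg ha.le (hnn hq')]

theorem exists_cyclic_next {ι : Type*} [LinearOrder ι] [Finite ι] [Nontrivial ι] (i : ι) :
    ∃ j, j ≠ i ∧ ∀ k, k ≠ i → k ≠ j → CyclicOrdered i j k := by
  by_cases hi : IsMax i
  · obtain ⟨j, hj⟩ : ∃ z : ι, ∀ i, z ≤ i := Finite.exists_min (id : ι → ι)
    refine ⟨j, ?_, fun k hki hkj => Or.inr (Or.inl ⟨lt_of_le_of_ne (hj k) hkj.symm,
      lt_of_le_of_ne (hi.isTop k) hki⟩)⟩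
    rintro rfl
    obtain ⟨k, hk⟩ := exists_ne j
    exact hk (le_antisymm (hi.isTop k) (hj k))
  · obtain ⟨j, hj⟩ := exists_covBy_of_wellFoundedLT hi
    refine ⟨j, hj.lt.ne', fun k hki hkj => ?_⟩
    rcases hki.lt_or_gt with h | h
    · exact Or.inr (Or.inr ⟨h, hj.lt⟩)
    · exact Or.inl ⟨hj.lt, lt_of_le_of_ne (not_lt.1 fun h' => hj.2 h h') hkj.symm⟩

theorem exists_cyclic_prev {ι : Type*} [LinearOrder ι] [Finite ι] [Nontrivial ι] (i : ι) :
    ∃ j, j ≠ i ∧ ∀ k, k ≠ i → k ≠ j → CyclicOrdered j i k := by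
  by_cases hi : IsMin i
  · obtain ⟨j, hj⟩ : ∃ z : ι, ∀ i, i ≤ z := Finite.exists_max (id : ι → ι)
    refine ⟨j, ?_, fun k hki hkj => Or.inr (Or.inl ⟨lt_of_le_of_ne (hi.isBot k) hki.symm,
      lt_of_le_of_ne (hj k) hkj⟩)⟩
    rintro rfl
    obtain ⟨k, hk⟩ := exists_ne j
    exact hk (le_antisymm (hj k) (hi.isBot k))
  · obtain ⟨j, hj⟩ := exists_covBy_of_wellFoundedGT hi
    refine ⟨j, hj.lt.ne, fun k hki hkj => ?_⟩
    rcases hki.lt_or_gt with h | h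
    · exact Or.inr (Or.inr ⟨lt_of_le_of_ne (not_lt.1 fun h' => hj.2 h' h) hkj, hj.lt⟩)
    · exact Or.inl ⟨hj.lt, h⟩

/-- The vertices of a convex polygon stay extreme in every realization of the order type of the
polygon together with points strictly inside of all its edges. -/
theorem image_mem_extremePts {ι : Type*} [LinearOrder ι] [Fintype ι] (hcard : 3 ≤ Fintype.card ι)
    {v : ι → Plane} (hv : ∀ i j k, i < j → j < k → 0 < area (v i) (v j) (v k))
    {P Q : Set Plane} (hvP : ∀ i, v i ∈ P)
    (hP : ∀ p ∈ P, (∃ i, p = v i) ∨ ∀ i j, i ≠ j →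
      (∀ k, k ≠ i → k ≠ j → 0 < area (v i) (v j) (v k)) → 0 < area (v i) (v j) p)
    (e : P ≃ Q) (he : ∀ x y z : P,
      orientation (e x : Plane) (e y : Plane) (e z : Plane) = orientation (x : Plane) y z)
    (i : ι) : (e ⟨v i, hvP i⟩ : Plane) ∈ extremePts Q := by
  have : Nontrivial ι := Fintype.one_lt_card_iff_nontrivial.1 (by omega)
  obtain ⟨j, hji, hj⟩ := exists_cyclic_prev i
  obtain ⟨k, hki, hk⟩ := exists_cyclic_next i
  have hj' : ∀ l, l ≠ j → l ≠ i → 0 < area (v j) (v i) (v l) :=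
    fun l h1 h2 => area_pos_of_cyclicOrdered hv (hj l h2 h1)
  have hk' : ∀ l, l ≠ i → l ≠ k → 0 < area (v i) (v k) (v l) :=
    fun l h1 h2 => area_pos_of_cyclicOrdered hv (hk l h1 h2)
  have hjk : j ≠ k := by
    rintro rfl
    obtain ⟨l, h1, h2⟩ : ∃ l, l ≠ i ∧ l ≠ j := by
      by_contra! h
      have h2 : (Finset.univ : Finset ι) ⊆ {i, j} := fun l _ => by
        by_cases hl : l = i
        · simp [hl]
        · simp [h l hl]
      have := Finset.card_le_card h2
      have := Finset.card_le_two (a := i) (b := j)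
      rw [Finset.card_univ] at *
      omega
    have a1 := hj' l h2 h1
    have a2 := hk' l h1 h2
    rw [← area_rotate, area_swap, area_rotate] at a1
    unfold area at a1 a2
    linarith
  have hnn : ∀ a b, a ≠ b → (∀ l, l ≠ a → l ≠ b → 0 < area (v a) (v b) (v l)) →
      ∀ p ∈ P, 0 ≤ area (v a) (v b) p := by
    intro a b hab h p hp
    rcases hP p hp with ⟨l, rfl⟩ | hp
    · by_cases h1 : l = a
      · rw [h1, area_self_left]
      by_cases h2 : l = b
      · rw [h2, area_self_right]
      exact (h l h1 h2).le
    · exact (hp a b hab h).le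
  refine mem_extremePts_of_supporting (x := e ⟨v j, hvP j⟩) (y := e ⟨v k, hvP k⟩)
    (Subtype.coe_prop _) ?_ ?_ ?_
  · intro q hq
    obtain ⟨p, hp⟩ := e.surjective ⟨q, hq⟩
    obtain rfl : (e p : Plane) = q := by rw [hp]
    rw [← orientation_nonneg_iff, he, orientation_nonneg_iff]
    exact hnn j i hji hj' p p.2
  · intro q hq
    obtain ⟨p, hp⟩ := e.surjective ⟨q, hq⟩
    obtain rfl : (e p : Plane) = q := by rw [hp]
    rw [← orientation_nonneg_iff, he, orientation_nonneg_iff]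
    exact hnn i k hki.symm hk' p p.2
  · intro q hq
    obtain ⟨p, hp⟩ := e.surjective ⟨q, hq⟩
    obtain rfl : (e p : Plane) = q := by rw [hp]
    intro h1 h2
    rw [← orientation_nonpos_iff, he, orientation_nonpos_iff] at h1 h2
    rcases hP p p.2 with ⟨l, hl⟩ | hp
    · simp only [hl] at h1 h2
      have hli : l = i := by
        by_contra hli
        by_cases hlj : l = j
        · exact h2.not_gt (hk' l hli (hlj ▸ hjk))
        · exact h1.not_gt (hj' l hlj hli)
      subst hli
      exact congrArg (fun x => (e x : Plane)) (Subtype.ext hl)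
    · exact absurd (hp j i hji hj') h1.not_gt

/-! ### Star configurations -/

section Lex

variable {n : ℕ}

theorem cyclicOrdered_toLex_same {i j : Fin n} (hij : i ≠ j) {s t : Fin 3} (hst : s < t)
    (u : Fin 3) : CyclicOrdered (toLex (i, s)) (toLex (i, t)) (toLex (j, u)) := by
  simp only [CyclicOrdered, Prod.Lex.toLex_lt_toLex]
  rcases hij.lt_or_gt with h | h
  · simp [h, hst]
  · simp [h, hst]

theorem toLex_lt_of_fst_lt {i j : Fin n} (hij : i < j) (s t : Fin 3) :
    toLex (i, s) < toLex (j, t) := Prod.Lex.toLex_lt_toLex.2 (Or.inl hij)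

theorem toLex_lt_of_snd_lt (i : Fin n) {s t : Fin 3} (hst : s < t) :
    toLex (i, s) < toLex (i, t) := Prod.Lex.toLex_lt_toLex.2 (Or.inr ⟨rfl, hst⟩)

end Lex

/-- Comparison of ratios of brackets over a cyclically ordered triple of groups. -/
theorem bracket_div_lt_bracket_div {n : ℕ} {x y : Fin n → Plane}
    (hx : ∀ i j, i < j → 0 < bracket (x i) (x j)) (hxy : ∀ i, bracket (x i) (y i) = 1)
    {i j k : Fin n} (h : CyclicOrdered i j k) :
    bracket (y j) (x k) / bracket (x j) (x k) < bracket (x i) (y j) / bracket (x i) (x j) := by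
  have hpos : 0 < bracket (x i) (x k) / (bracket (x i) (x j) * bracket (x j) (x k)) := by
    rcases h with ⟨h1, h2⟩ | ⟨h1, h2⟩ | ⟨h1, h2⟩
    · exact div_pos (hx _ _ (h1.trans h2)) (mul_pos (hx _ _ h1) (hx _ _ h2))
    · rw [bracket_swap (x k), bracket_swap (x j) (x i), neg_mul, neg_div_neg_eq]
      exact div_pos (hx _ _ h2) (mul_pos (hx _ _ (h1.trans h2)) (hx _ _ h1))
    · rw [bracket_swap (x k), bracket_swap (x k) (x j), mul_neg, neg_div_neg_eq]
      exact div_pos (hx _ _ h1) (mul_pos (hx _ _ h2) (hx _ _ (h1.trans h2)))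
  have h1 : bracket (x i) (x j) ≠ 0 := fun h => by simp [h] at hpos
  have h2 : bracket (x j) (x k) ≠ 0 := fun h => by simp [h] at hpos
  have hp := plucker (x i) (y j) (x j) (x k)
  rw [hxy j, mul_one] at hp
  rw [← sub_pos]
  convert hpos using 1
  rw [div_sub_div _ _ h1 h2, hp]

/-- The point `d i`, placed relative to the chords from group `i` to group `j` as in a star
configuration, makes the transition from group `i` to group `j` have negative trace; here in terms
of ratios that do not depend on the order of `i` and `j`. -/
theorem bracket_div_lt_bracket_div_of_chords {n : ℕ} {v u : Fin n ×ₗ Fin 3 → Plane}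
    {w : Fin n ×ₗ Fin 3 → ℝ} {α β μ : Fin n → ℝ} {x y : Fin n → Plane} {d : Plane} {e f g : ℝ}
    (hu : ∀ i j, i < j → 0 < bracket (u i) (u j)) (hw : ∀ i, 0 < w i)
    (hd : ∀ i j, area (v i) (v j) d * (w i * w j) =
      bracket (u i) (u j) * polarForm e f g (u i) (u j))
    (hα : ∀ i, 0 < α i) (hβ : ∀ i, 0 < β i) (hμ : ∀ i, 0 < μ i)
    (hx : ∀ i, x i = α i • u (toLex (i, 0))) (hy : ∀ i, y i = β i • u (toLex (i, 2)))
    (hb : ∀ i, x i + y i = μ i • u (toLex (i, 1))) (hxy : ∀ i, bracket (x i) (y i) = 1)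
    {i j : Fin n} (hij : i ≠ j)
    (h0 : area (v (toLex (i, 0))) (v (toLex (j, 0))) d ≤ 0)
    (h1 : 0 < area (v (toLex (i, 1))) (v (toLex (j, 1))) d)
    (h2 : area (v (toLex (i, 2))) (v (toLex (j, 2))) d ≤ 0)
    (h3 : 0 < area (v (toLex (i, 0))) (v (toLex (i, 2))) d) :
    bracket (x i) (y j) / bracket (x i) (x j) < bracket (y i) (x j) / bracket (x i) (x j) := by
  -- The sign `ε` turns the vectors of group `j` so that they follow those of group `i`.
  obtain ⟨ε, hε, hεu⟩ : ∃ ε : ℝ, ε * ε = 1 ∧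
      ∀ s t : Fin 3, 0 < ε * bracket (u (toLex (i, s))) (u (toLex (j, t))) := by
    rcases hij.lt_or_gt with h | h
    · exact ⟨1, by norm_num, fun s t => by
        rw [one_mul]; exact hu _ _ (toLex_lt_of_fst_lt h s t)⟩
    · exact ⟨-1, by norm_num, fun s t => by
        rw [bracket_swap, neg_one_mul, neg_neg]; exact hu _ _ (toLex_lt_of_fst_lt h t s)⟩
  have hform : ∀ s : Fin 3, area (v (toLex (i, s))) (v (toLex (j, s))) d *
      (w (toLex (i, s)) * w (toLex (j, s))) =
      (ε * bracket (u (toLex (i, s))) (u (toLex (j, s)))) *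
        (ε * polarForm e f g (u (toLex (i, s))) (u (toLex (j, s)))) := by
    intro s
    rw [hd, mul_mul_mul_comm, hε, one_mul]
  have hww : ∀ s : Fin 3, 0 < w (toLex (i, s)) * w (toLex (j, s)) := fun s => mul_pos (hw _) (hw _)
  have hle : ∀ s : Fin 3, area (v (toLex (i, s))) (v (toLex (j, s))) d ≤ 0 →
      ε * polarForm e f g (u (toLex (i, s))) (u (toLex (j, s))) ≤ 0 := by
    intro s hs
    by_contra! hp
    have := mul_pos (hεu s s) hp
    rw [← hform s] at this
    exact this.not_ge (mul_nonpos_of_nonpos_of_nonneg hs (hww s).le)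
  have hlt : 0 < ε * polarForm e f g (u (toLex (i, 1))) (u (toLex (j, 1))) := by
    have := mul_pos h1 (hww 1)
    rw [hform 1] at this
    exact pos_of_mul_pos_right this (hεu 1 1).le
  have hbr : ∀ {a b : ℝ} {s t : Fin 3}, 0 < a → 0 < b →
      0 < bracket (a • u (toLex (i, s))) (ε • b • u (toLex (j, t))) := by
    intro a b s t ha hb
    rw [smul_smul, bracket_smul_smul]
    have := mul_pos (mul_pos ha hb) (hεu s t)
    linarith
  have key : bracket (x i) (ε • y j) < bracket (y i) (ε • x j) := by
    refine bracket_lt_bracket_of_polarForm (e := e) (f := f) (g := g) (hxy i) ?_ ?_ ?_ ?_ ?_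
      ?_ ?_ ?_ ?_
    · rw [bracket_smul_smul, hε, hxy, one_mul]
    · rw [hx, hy]; exact hbr (hα i) (hβ j)
    · rw [hx, hy]; exact hbr (hβ i) (hα j)
    · rw [hx, hx]; exact hbr (hα i) (hα j)
    · rw [hy, hy]; exact hbr (hβ i) (hβ j)
    · rw [hx, hx, smul_smul, polarForm_smul_smul]
      linarith [mul_nonpos_of_nonneg_of_nonpos (mul_pos (hα i) (hα j)).le (hle 0 h0)]
    · rw [hy, hy, smul_smul, polarForm_smul_smul]
      linarith [mul_nonpos_of_nonneg_of_nonpos (mul_pos (hβ i) (hβ j)).le (hle 2 h2)]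
    · rw [← smul_add, hb, hb, smul_smul, polarForm_smul_smul]
      linarith [mul_pos (mul_pos (hμ i) (hμ j)) hlt]
    · rw [hx, hy, polarForm_smul_smul]
      refine mul_pos (mul_pos (hα i) (hβ i)) ?_
      have := mul_pos h3 (mul_pos (hw (toLex (i, 0))) (hw (toLex (i, 2))))
      rw [hd] at this
      exact pos_of_mul_pos_right this (hu _ _ (toLex_lt_of_snd_lt i (by decide))).le
  have hden : 0 < ε * bracket (x i) (x j) := by
    have := hbr (s := 0) (t := 0) (hα i) (hα j)
    rw [← hx, ← hx] at this
    have e := bracket_smul_smul 1 ε (x i) (x j)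
    rw [one_smul, one_mul] at e
    rwa [e] at this
  have hεne : ε ≠ 0 := fun h => by simp [h] at hε
  have e1 := bracket_smul_smul 1 ε (x i) (y j)
  have e2 := bracket_smul_smul 1 ε (y i) (x j)
  rw [one_smul, one_mul] at e1 e2
  rw [e1, e2] at key
  rw [← mul_div_mul_left (bracket (x i) (y j)) _ hεne,
    ← mul_div_mul_left (bracket (y i) (x j)) _ hεne]
  exact div_lt_div_of_pos_right key hden

/-- Points on a conic cannot carry the chord conditions of a star configuration. -/
theorem false_of_conic_of_chords {n : ℕ} [NeZero n] (hn : 3 ≤ n) {σ : Equiv.Perm (Fin n)}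
    (hσ : ∀ k, CyclicOrdered (σ k) (σ (k + 1)) (σ (k + 2)))
    {v : Fin n ×ₗ Fin 3 → Plane} (hv : ∀ i j k, i < j → j < k → 0 < area (v i) (v j) (v k))
    {d : Fin n → Plane}
    (hd : ∀ k, area (v (toLex (σ k, 0))) (v (toLex (σ (k + 1), 0))) (d (σ k)) ≤ 0 ∧
      0 < area (v (toLex (σ k, 1))) (v (toLex (σ (k + 1), 1))) (d (σ k)) ∧
      area (v (toLex (σ k, 2))) (v (toLex (σ (k + 1), 2))) (d (σ k)) ≤ 0 ∧
      0 < area (v (toLex (σ k, 0))) (v (toLex (σ k, 2))) (d (σ k)))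
    {A B C D E F : ℝ} (hABC : A ≠ 0 ∨ B ≠ 0 ∨ C ≠ 0)
    (hconic : ∀ i, A * (v i).1 ^ 2 + B * ((v i).1 * (v i).2) + C * (v i).2 ^ 2
      + D * (v i).1 + E * (v i).2 + F = 0) : False := by
  have hcard : 6 ≤ Fintype.card (Fin n ×ₗ Fin 3) := by
    rw [Fintype.card_lex, Fintype.card_prod, Fintype.card_fin, Fintype.card_fin]; omega
  obtain ⟨u, hu, w, hw, hpar⟩ := exists_parametrization hcard hv hABC hconic
  have hframe : ∀ i : Fin n, ∃ α β μ : ℝ, 0 < α ∧ 0 < β ∧ 0 < μ ∧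
      α • u (toLex (i, 0)) + β • u (toLex (i, 2)) = μ • u (toLex (i, 1)) ∧
      α * β * bracket (u (toLex (i, 0))) (u (toLex (i, 2))) = 1 := fun i =>
    exists_normalized_frame (hu _ _ (toLex_lt_of_snd_lt i (by decide)))
      (hu _ _ (toLex_lt_of_snd_lt i (by decide))) (hu _ _ (toLex_lt_of_snd_lt i (by decide)))
  choose α β μ hα hβ hμ hb hdet using hframe
  set x : Fin n → Plane := fun i => α i • u (toLex (i, 0)) with hx
  set y : Fin n → Plane := fun i => β i • u (toLex (i, 2)) with hy
  have hxy : ∀ i, bracket (x i) (y i) = 1 := fun i => by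
    simp only [hx, hy]; rw [bracket_smul_smul, hdet]
  have hxx : ∀ i j, i < j → 0 < bracket (x i) (x j) := fun i j hij => by
    simp only [hx]
    rw [bracket_smul_smul]
    exact mul_pos (mul_pos (hα i) (hα j)) (hu _ _ (toLex_lt_of_fst_lt hij 0 0))
  -- The ratios strictly decrease along the closed sequence `σ 0, σ 1, …`.
  set s : Fin n → ℝ := fun k =>
    bracket (y (σ k)) (x (σ (k + 1))) / bracket (x (σ k)) (x (σ (k + 1))) with hs
  have hdec : ∀ k, s (k + 1) < s k := by
    intro k
    have h12 : k + 1 + 1 = k + 2 := by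
      rw [add_assoc]
      congr 1
      exact Fin.ext (by rw [Fin.val_add]; exact (Nat.add_mod 1 1 n).symm)
    simp only [hs, h12]
    refine (bracket_div_lt_bracket_div hxx hxy (hσ k)).trans ?_
    obtain ⟨e, f, g, hefg⟩ := hpar (d (σ k))
    obtain ⟨h0, h1, h2, h3⟩ := hd k
    exact bracket_div_lt_bracket_div_of_chords hu hw hefg hα hβ hμ (fun _ => rfl) (fun _ => rfl)
      hb hxy (hσ k).ne h0 h1 h2 h3
  obtain ⟨k, hk⟩ := Finite.exists_min s
  exact (hdec k).not_ge (hk (k + 1))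

/-- In a configuration of the family, the point `d (σ k)` is strictly inside of every edge of the
polygon formed by the points `a`, `b`, `c`. -/
theorem area_edge_pos_of_mem_triangle {n : ℕ} {v : Fin n ×ₗ Fin 3 → Plane}
    (hv : ∀ i j k, i < j → j < k → 0 < area (v i) (v j) (v k)) {i j : Fin n} (hij : i ≠ j)
    {d : Plane}
    (hd : d ∈ triangleOfLines (line[ℝ, v (toLex (i, 0)), v (toLex (j, 0))])
      (line[ℝ, v (toLex (i, 1)), v (toLex (j, 1))]) (line[ℝ, v (toLex (i, 2)), v (toLex (j, 2))]))
    {p q : Fin n ×ₗ Fin 3}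
    (hpq : ∀ k, k ≠ p → k ≠ q → 0 < area (v p) (v q) (v k)) : 0 < area (v p) (v q) d := by
  have hnn : ∀ k, 0 ≤ area (v p) (v q) (v k) := by
    intro k
    by_cases h1 : k = p
    · rw [h1, area_self_left]
    by_cases h2 : k = q
    · rw [h2, area_self_right]
    exact (hpq k h1 h2).le
  refine triangle_subset_of_convex (w := fun s => v (toLex (i, s)))
    (w' := fun s => v (toLex (j, s)))
    (fun s t r hst => area_pos_of_cyclicOrdered hv (cyclicOrdered_toLex_same hij hst r))
    (fun s t r hst => area_pos_of_cyclicOrdered hv (cyclicOrdered_toLex_same hij.symm hst r))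
    (convex_area_pos (v p) (v q)) ?_ hd
  intro s t hst x hx hx'
  by_cases h1 : 0 < area (v p) (v q) (v (toLex (i, s))) ∨ 0 < area (v p) (v q) (v (toLex (j, s)))
  · exact area_pos_of_mem_openSegment hx (hnn _) (hnn _) h1
  · -- If the edge joins the ends of one chord, then it misses the ends of the other.
    refine area_pos_of_mem_openSegment hx' (hnn _) (hnn _) (Or.inl ?_)
    have hmem : ∀ k, ¬ 0 < area (v p) (v q) (v k) → k = p ∨ k = q := fun k hk => by
      by_contra! h
      exact hk (hpq k h.1 h.2)
    rw [not_or] at h1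
    have m1 := hmem _ h1.1
    have m2 := hmem _ h1.2
    have n1 : toLex (i, s) ≠ toLex (j, s) := fun h => hij (congrArg (fun z => (ofLex z).1) h)
    have n2 : toLex (i, t) ≠ toLex (i, s) := fun h => hst.ne' (congrArg (fun z => (ofLex z).2) h)
    have n3 : toLex (i, t) ≠ toLex (j, s) := fun h => hij (congrArg (fun z => (ofLex z).1) h)
    by_contra hcon
    have m3 := hmem _ hcon
    rcases m1 with m1 | m1 <;> rcases m2 with m2 | m2 <;> rcases m3 with m3 | m3 <;>
      first
      | exact n1 (m1.trans m2.symm)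
      | exact n2 (m3.trans m1.symm)
      | exact n3 (m3.trans m2.symm)

end StarConfig

open StarConfig in
theorem mainTheorem10 (n : ℕ) [NeZero n] (hn : 3 ≤ n) (P : Set StarConfig.Plane)
    (hP : StarConfig.IsStarConfiguration n P) :
    ¬ StarConfig.RealizableWithExtremePtsOnConic P := by
  rintro ⟨Q, ⟨e, he⟩, γ, ⟨A, B, C, D, E, F, hABC, rfl⟩, hext⟩
  obtain ⟨σ, hσ, a, b, c, d, hPeq, ⟨-, hccw⟩, hd⟩ := hP
  have hcyc := hσ.cyclicOrdered hn
  set v := interleave a b c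
  have hv : ∀ i j k, i < j → j < k → 0 < area (v i) (v j) (v k) :=
    fun i j k h1 h2 => orientation_eq_one_iff.1 (hccw i j k h1 h2)
  have hne : ∀ k, σ k ≠ σ (k + 1) := fun k => (hcyc k).ne
  have hvP : ∀ i, v i ∈ P := by
    intro i
    obtain ⟨⟨i, s⟩, rfl⟩ := toLex.surjective i
    rw [hPeq]
    fin_cases s
    · exact Or.inl (Or.inl (Or.inl ⟨i, rfl⟩))
    · exact Or.inl (Or.inl (Or.inr ⟨i, rfl⟩))
    · exact Or.inl (Or.inr ⟨i, rfl⟩)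
  have hdP : ∀ i, d i ∈ P := fun i => by rw [hPeq]; exact Or.inr ⟨i, rfl⟩
  have hmem : ∀ p ∈ P, (∃ i, p = v i) ∨ ∀ i j, i ≠ j →
      (∀ k, k ≠ i → k ≠ j → 0 < area (v i) (v j) (v k)) → 0 < area (v i) (v j) p := by
    intro p hp
    rw [hPeq] at hp
    rcases hp with ((⟨i, rfl⟩ | ⟨i, rfl⟩) | ⟨i, rfl⟩) | ⟨i, rfl⟩
    · exact Or.inl ⟨toLex (i, 0), rfl⟩
    · exact Or.inl ⟨toLex (i, 1), rfl⟩
    · exact Or.inl ⟨toLex (i, 2), rfl⟩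
    · right
      obtain ⟨k, rfl⟩ := σ.surjective i
      intro p q _ hpq
      exact area_edge_pos_of_mem_triangle hv (hne k) (hd k).1 hpq
  have hcard : 3 ≤ Fintype.card (Fin n ×ₗ Fin 3) := by
    rw [Fintype.card_lex, Fintype.card_prod, Fintype.card_fin, Fintype.card_fin]; omega
  have hextreme := image_mem_extremePts hcard hv hvP hmem e he
  refine false_of_conic_of_chords hn hcyc (v := fun i => (e ⟨v i, hvP i⟩ : Plane))
    (d := fun i => (e ⟨d i, hdP i⟩ : Plane)) ?_ ?_ hABC (fun i => hext (hextreme i))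
  · intro i j k h1 h2
    rw [← orientation_eq_one_iff, he]
    exact hccw i j k h1 h2
  · intro k
    have h := fun s t r hst => area_pos_of_cyclicOrdered hv
      (cyclicOrdered_toLex_same (s := s) (t := t) (hne k) hst r)
    have h' := fun s t r hst => area_pos_of_cyclicOrdered hv
      (cyclicOrdered_toLex_same (s := s) (t := t) (hne k).symm hst r)
    have hmid := orientation_eq_one_iff.1 (hd k).2
    obtain ⟨h0, h2⟩ := area_outer_chords_nonpos (w := fun s => v (toLex (σ k, s)))
      (w' := fun s => v (toLex (σ (k + 1), s))) h h' (hd k).1 hmid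
    have h3 := area_first_last_pos (w := fun s => v (toLex (σ k, s)))
      (w' := fun s => v (toLex (σ (k + 1), s))) h h' (hd k).1
    refine ⟨?_, ?_, ?_, ?_⟩
    · rw [← orientation_nonpos_iff, he, orientation_nonpos_iff]; exact h0
    · rw [← orientation_eq_one_iff, he]; exact (hd k).2
    · rw [← orientation_nonpos_iff, he, orientation_nonpos_iff]; exact h2
    · rw [← orientation_eq_one_iff, he, orientation_eq_one_iff]; exact h3
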